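/- Let $(\mathcal M,g)$ be a Lorentzian spacetime of dimension $d\ge 2$ with metric $g$ of class $C^2$ and signature $(+,-,\dots,-)$. Let $\mathcal H$ be a complex Hilbert space, $\mathcal D\subset\mathcal H$ a dense linear subspace, and let $\hat\psi$ assign to every $x\in\mathcal M$ a linear map $\hat\psi(x):\mathcal D\to\mathcal H$. Assume that $\hat\psi(x)\mathcal D\subset\mathcal D$, that $\mathcal D$ is contained in the domain of the adjoint $\hat\psi(x)^\dagger$, and that $\hat\psi(x)^\dagger\mathcal D\subset\mathcal D$, for all $x\in\mathcal M$. Assume also that $\hat\psi$ is weakly continuous at every point, i.e. $x\mapsto\langle\phi,\hat\psi(x)\chi\rangle$ is continuous at every point of $\mathcal M$ for all $\phi,\chi\in\mathcal D$. Write $\{A,B\}=AB+BA$; all operator equalities are understood on $\mathcal D$. (i) Call $x\ne y$ spacelike separated if they are joined by a spacelike geodesic (a geodesic $\gamma$ with $g(\dot\gamma,\dot\gamma)<0$). Then $$\{\hat\psi(x)^\dagger,\hat\psi(y)\}=0\ \text{ for all spacelike separated } x,y\in\mathcal M\quad\Longleftrightarrow\quad \hat\psi(x)=0\ \text{ for all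 } x\in\mathcal M .$$ (ii) If $(\mathcal M,g)$ is distinguishing (every neighbourhood $U$ of a point $x$ contains a neighbourhood $V$ of $x$ such that every causal curve from $x$ that ends in $V$ stays in $U$; this holds for instance if $(\mathcal M,g)$ is strongly causal or globally hyperbolic), then the same equivalence holds with "spacelike separated" read as "causally disjoint": $x\neq y$ and no causal curve joins $x$ and $y$. -/

import Mathlib

open Set Filter Topology
open scoped Manifold ContDiff InnerProductSpace

noncomputable section

/-! ### Lorentzian metrics -/

/-- A Lorentzian metric of class `C^2`, in mostly minus signature `(+, -, ..., -)`, on a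
`d`-dimensional manifold `M` (of class `C^3` at least, so that `C^2` metric tensors make sense). -/
structure LorentzianMetric (d : ℕ) (M : Type*) [TopologicalSpace M]
    [ChartedSpace (EuclideanSpace ℝ (Fin d)) M] [IsManifold (𝓡 d) 3 M] where
  /-- The bilinear form on each tangent space. -/
  val : ∀ x : M, TangentSpace (𝓡 d) x →L[ℝ] TangentSpace (𝓡 d) x →L[ℝ] ℝ
  symm : ∀ (x : M) (v w : TangentSpace (𝓡 d) x), val x v w = val x w v
  /-- Each tangent space has an orthonormal basis of signature `(+, -, ..., -)`. -/
  exists_orthonormal_basis : ∀ x : M,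
    ∃ e : Module.Basis (Fin d) ℝ (TangentSpace (𝓡 d) x), ∀ i j : Fin d,
      val x (e i) (e j) = if i = j then (if (i : ℕ) = 0 then 1 else -1) else 0
  contMDiff : ContMDiff (𝓡 d)
    ((𝓡 d).prod 𝓘(ℝ, EuclideanSpace ℝ (Fin d) →L[ℝ] EuclideanSpace ℝ (Fin d) →L[ℝ] ℝ)) 2
    (fun x ↦ Bundle.TotalSpace.mk'
      (EuclideanSpace ℝ (Fin d) →L[ℝ] EuclideanSpace ℝ (Fin d) →L[ℝ] ℝ) x (val x))

/-- The velocity of a curve `γ` in `M` at the parameter `t`. -/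
def curveVelocity {d : ℕ} {M : Type*} [TopologicalSpace M]
    [ChartedSpace (EuclideanSpace ℝ (Fin d)) M] (γ : ℝ → M) (t : ℝ) :
    TangentSpace (𝓡 d) (γ t) :=
  mfderiv 𝓘(ℝ, ℝ) (𝓡 d) γ t (1 : ℝ)

namespace LorentzianMetric

variable {d : ℕ} {M : Type*} [TopologicalSpace M]
  [ChartedSpace (EuclideanSpace ℝ (Fin d)) M] [IsManifold (𝓡 d) 3 M]

/-- The metric read in the chart `φ = chartAt _ p`: the bilinear form
`(a, b) ↦ g(Dφ⁻¹(u) a, Dφ⁻¹(u) b)` on `ℝ^d`, for `u` in the target of `φ`. -/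
def inChart (g : LorentzianMetric d M) (p : M) (u : EuclideanSpace ℝ (Fin d)) :
    EuclideanSpace ℝ (Fin d) →L[ℝ] EuclideanSpace ℝ (Fin d) →L[ℝ] ℝ :=
  let φ := chartAt (EuclideanSpace ℝ (Fin d)) p
  let A : EuclideanSpace ℝ (Fin d) →L[ℝ] EuclideanSpace ℝ (Fin d) :=
    mfderiv 𝓘(ℝ, EuclideanSpace ℝ (Fin d)) (𝓡 d) φ.symm u
  let B : EuclideanSpace ℝ (Fin d) →L[ℝ] EuclideanSpace ℝ (Fin d) →L[ℝ] ℝ := g.val (φ.symm u)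
  B.bilinearComp A A

/-- Christoffel symbols of the first kind in the chart at `p`, contracted with constant vectors:
`Γ(a, b; w) = ½ (∂_a g(b, w) + ∂_b g(a, w) - ∂_w g(a, b))`. -/
def christoffelFirst (g : LorentzianMetric d M) (p : M) (u a b w : EuclideanSpace ℝ (Fin d)) : ℝ :=
  (1 / 2) * (fderiv ℝ (g.inChart p) u a b w + fderiv ℝ (g.inChart p) u b a w
    - fderiv ℝ (g.inChart p) u w a b)

/-- `γ` satisfies the geodesic equation at `t`: in a chart around `γ t` its coordinate expression
`c` is `C^2` near `t` and `g(c'', w) + Γ(c', c'; w) = 0` at `t` for all `w`. (With the index raised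
this is `c''^k + Γ^k_{ij} c'^i c'^j = 0`; the condition does not depend on the chart.) -/
def IsGeodesicAt (g : LorentzianMetric d M) (γ : ℝ → M) (t : ℝ) : Prop :=
  ContinuousAt γ t ∧ ∃ p : M, γ t ∈ (chartAt (EuclideanSpace ℝ (Fin d)) p).source ∧
    let c : ℝ → EuclideanSpace ℝ (Fin d) := fun s ↦ chartAt (EuclideanSpace ℝ (Fin d)) p (γ s)
    ContDiffAt ℝ 2 c t ∧ ∀ w : EuclideanSpace ℝ (Fin d),
      g.inChart p (c t) (deriv (deriv c) t) w
        + g.christoffelFirst p (c t) (deriv c t) (deriv c t) w = 0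

/-- Two distinct points are geodesically spacelike separated if they are joined by a spacelike
geodesic. -/
def GeodesicallySpacelikeSeparated (g : LorentzianMetric d M) (x y : M) : Prop :=
  x ≠ y ∧ ∃ (γ : ℝ → M) (a b : ℝ), a < b ∧ γ a = x ∧ γ b = y ∧ ∀ t ∈ Icc a b,
    g.IsGeodesicAt γ t ∧ g.val (γ t) (curveVelocity γ t) (curveVelocity γ t) < 0

/-- `γ` is a causal curve on `[a, b]`: a regular `C^1` curve whose velocity is everywhere timelike
or null. (By regularity the velocity cannot jump between the two halves of the light cone.) -/
def IsCausalCurveOn (g : LorentzianMetric d M) (γ : ℝ → M) (a b : ℝ) : Prop :=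
  ∀ t ∈ Icc a b, ContMDiffAt 𝓘(ℝ, ℝ) (𝓡 d) 1 γ t ∧ curveVelocity (d := d) γ t ≠ 0 ∧
    0 ≤ g.val (γ t) (curveVelocity γ t) (curveVelocity γ t)

/-- Two distinct points are causally disjoint if no causal curve joins them. (Reversing the
parameter of a causal curve gives a causal curve, so this relation is symmetric.) -/
def CausallyDisjoint (g : LorentzianMetric d M) (x y : M) : Prop :=
  x ≠ y ∧ ¬ ∃ (γ : ℝ → M) (a b : ℝ), a < b ∧ γ a = x ∧ γ b = y ∧ g.IsCausalCurveOn γ a b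

/-- The spacetime is (past and future) distinguishing: every neighbourhood `U` of a point `x`
contains a neighbourhood `V` of `x` such that causal curves from `x` which end in `V` stay
in `U`. -/
def IsDistinguishing (g : LorentzianMetric d M) : Prop :=
  ∀ x : M, ∀ U ∈ 𝓝 x, ∃ V ∈ 𝓝 x, V ⊆ U ∧ ∀ (γ : ℝ → M) (a b : ℝ), a < b → γ a = x →
    γ b ∈ V → g.IsCausalCurveOn γ a b → ∀ t ∈ Icc a b, γ t ∈ U

end LorentzianMetric

/-! ### Operators on a common dense domain -/

section Operators

variable {H : Type*} [NormedAddCommGroup H] [InnerProductSpace ℂ H] [CompleteSpace H]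

/-- A linear map `D → H` as an (unbounded) operator on `H` with domain `D`. -/
def operatorOn (D : Submodule ℂ H) (A : D →ₗ[ℂ] H) : H →ₗ.[ℂ] H := ⟨D, A⟩

/-- The domain `D` is invariant under `A` and under its Hilbert space adjoint: `A D ⊆ D`, `D` lies
in the domain of `A†`, and `A† D ⊆ D`. -/
structure DomainInvariant (D : Submodule ℂ H) (A : D →ₗ[ℂ] H) : Prop where
  map_mem : ∀ χ : D, A χ ∈ D
  le_adjoint_domain : D ≤ (operatorOn D A).adjoint.domain
  adjoint_map_mem : ∀ χ : D, (operatorOn D A).adjoint ⟨χ, le_adjoint_domain χ.2⟩ ∈ D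

namespace DomainInvariant

variable {D : Submodule ℂ H} {A : D →ₗ[ℂ] H}

/-- `A` as a linear endomorphism of `D`. -/
def op (h : DomainInvariant D A) : Module.End ℂ D := A.codRestrict D h.map_mem

/-- The restriction of the Hilbert space adjoint `A†` to `D`, as a linear endomorphism of `D`. -/
def adj (h : DomainInvariant D A) : Module.End ℂ D :=
  ((operatorOn D A).adjoint.toFun ∘ₗ Submodule.inclusion h.le_adjoint_domain).codRestrict D
    h.adjoint_map_mem

end DomainInvariant

/-- The anticommutator `{A, B} = AB + BA` of two endomorphisms of `D`. -/
def anticommutator {D : Submodule ℂ H} (A B : Module.End ℂ D) : Module.End ℂ D := A * B + B * A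

end Operators

/-- A field `ψ` of operators on `D` is weakly continuous: all matrix elements `⟨φ, ψ(x) χ⟩` with
`φ, χ ∈ D` are continuous at every point `x`. -/
def WeaklyContinuous {M : Type*} [TopologicalSpace M] {H : Type*} [NormedAddCommGroup H]
    [InnerProductSpace ℂ H] (D : Submodule ℂ H) (ψ : M → D →ₗ[ℂ] H) : Prop :=
  ∀ (x : M) (φ χ : D), ContinuousAt (fun y ↦ inner ℂ (φ : H) (ψ y χ)) x

end

/-! ### Anticommutators and the coincidence limit -/

section Operators

variable {H : Type*} [NormedAddCommGroup H] [InnerProductSpace ℂ H] [CompleteSpace H]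

/-! For `χ` in `D`, the expectation value of `{ψ(x)†, ψ(y)}` in `χ` is `⟨ψ(x)χ, ψ(y)χ⟩ + ⟨χ,
ψ(y)ψ(x)†χ⟩`. By weak continuity it tends to `‖ψ(x)χ‖² + ‖ψ(x)†χ‖²` as `y → x`. If it vanishes for
some `y` in every neighbourhood of `x`, both squares vanish
(`eq_zero_of_frequently_anticommutator_eq_zero`). It remains to show that separated points
accumulate at every `x`.

For (i), run a short geodesic from `x` with spacelike initial velocity
(`frequently_geodesicallySpacelikeSeparated`); the metric is `C^2`, so the geodesic field is `C^1`
and Picard–Lindelöf applies.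

For (ii), pair with a timelike vector at `x` to get a covector `τ`, frozen in the chart. Near `x`
the metric is negative definite on `ker τ`, so `τ` is nonzero on causal velocities, and by Rolle no
causal curve staying nearby joins two points of equal `τ`. The distinguishing condition excludes
curves that wander off and return (`IsDistinguishing.frequently_causallyDisjoint`). -/

/-- The defining property of the adjoint, on the invariant domain. -/
theorem DomainInvariant.inner_adj_left {D : Submodule ℂ H} (hD : Dense (D : Set H))
    {A : D →ₗ[ℂ] H} (h : DomainInvariant D A) (φ χ : D) :
    inner ℂ ((h.adj φ : D) : H) (χ : H) = inner ℂ (φ : H) (A χ) :=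
  (LinearPMap.adjoint_isFormalAdjoint (T := operatorOn D A) hD)
    ⟨φ, h.le_adjoint_domain φ.2⟩ χ

/-- If `ψ(x)†` anticommutes with `ψ(y)` for points `y` arbitrarily close to `x`, then
`ψ(x) = 0`. -/
theorem eq_zero_of_frequently_anticommutator_eq_zero {M : Type*} [TopologicalSpace M]
    {D : Submodule ℂ H} (hD : Dense (D : Set H)) {ψ : M → D →ₗ[ℂ] H}
    (hcont : WeaklyContinuous D ψ) (hinv : ∀ x : M, DomainInvariant D (ψ x)) {x : M}
    (hx : ∃ᶠ y in 𝓝 x, anticommutator (hinv x).adj (hinv y).op = 0) : ψ x = 0 := by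
  ext χ
  set a : D := (hinv x).adj χ with ha
  have key : ∀ y, inner ℂ (χ : H) ((anticommutator (hinv x).adj (hinv y).op χ : D) : H)
      = inner ℂ (ψ x χ) (ψ y χ) + inner ℂ (χ : H) (ψ y a) := by
    intro y
    have h := (hinv x).inner_adj_left hD ((hinv y).op χ) χ
    have h' : inner ℂ (χ : H) (((hinv x).adj ((hinv y).op χ) : D) : H)
        = inner ℂ (ψ x χ) (ψ y χ) := by
      rw [← inner_conj_symm, h, inner_conj_symm]
      rfl
    rw [← h', ← inner_add_right]
    rfl
  -- Only `ψ y` varies. The other vectors are fixed and lie in `D` because `D` is invariant under `ψ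
  -- x` and its adjoint.
  have hlim : Tendsto (fun y ↦ inner ℂ (ψ x χ) (ψ y χ) + inner ℂ (χ : H) (ψ y a)) (𝓝 x)
      (𝓝 (inner ℂ (ψ x χ) (ψ x χ) + inner ℂ (χ : H) (ψ x a))) :=
    (hcont x ⟨ψ x χ, (hinv x).map_mem χ⟩ χ).add (hcont x χ a)
  have hzero : inner ℂ (ψ x χ) (ψ x χ) + inner ℂ (χ : H) (ψ x a) ∈ ({0} : Set ℂ) := by
    refine isClosed_singleton.mem_of_frequently_of_tendsto (hx.mono fun y hy ↦ ?_) hlim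
    rw [mem_singleton_iff, ← key, hy]
    simp
  rw [mem_singleton_iff, ← (hinv x).inner_adj_left hD χ a, ← ha, inner_self_eq_norm_sq_to_K,
    inner_self_eq_norm_sq_to_K] at hzero
  have hreal : ‖ψ x χ‖ ^ 2 + ‖(a : H)‖ ^ 2 = 0 := by
    refine Complex.ofReal_injective ?_
    push_cast
    exact hzero
  have : ‖ψ x χ‖ ^ 2 = 0 := by nlinarith [sq_nonneg ‖ψ x χ‖, sq_nonneg ‖(a : H)‖]
  simpa using this

/-- The anticommutators of a vanishing field vanish. -/
theorem anticommutator_eq_zero_of_eq_zero {D : Submodule ℂ H} {A B : D →ₗ[ℂ] H}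
    (hA : DomainInvariant D A) (hB : DomainInvariant D B) (h : B = 0) :
    anticommutator hA.adj hB.op = 0 := by
  have : hB.op = 0 := by
    ext χ
    simp [DomainInvariant.op, h]
  simp [anticommutator, this]

end Operators

/-! ### The metric in chart coordinates -/

namespace LorentzianMetric

variable {d : ℕ} {M : Type*} [TopologicalSpace M]
  [ChartedSpace (EuclideanSpace ℝ (Fin d)) M] [IsManifold (𝓡 d) 3 M]

local notation "𝔼" => EuclideanSpace ℝ (Fin d)

theorem inChart_apply (g : LorentzianMetric d M) (p : M) (u a b : 𝔼) :
    g.inChart p u a b = g.val ((chartAt 𝔼 p).symm u)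
      (mfderiv 𝓘(ℝ, 𝔼) (𝓡 d) (chartAt 𝔼 p).symm u a)
      (mfderiv 𝓘(ℝ, 𝔼) (𝓡 d) (chartAt 𝔼 p).symm u b) := rfl

theorem mdifferentiable_chartAt (p : M) :
    (chartAt 𝔼 p).MDifferentiable (𝓡 d) (𝓡 d) :=
  have : IsManifold (𝓡 d) 1 M := .of_le (n := 3) (by norm_num)
  mdifferentiable_chart p

/-- The metric coefficients are of class `C^2`. -/
theorem contDiffAt_inChart (g : LorentzianMetric d M) (p : M) {u : 𝔼}
    (hu : u ∈ (chartAt 𝔼 p).target) : ContDiffAt ℝ 2 (g.inChart p) u := by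
  have i1 : IsManifold (𝓡 d) 1 M := .of_le (n := 3) (by norm_num)
  have i2 : IsManifold (𝓡 d) 2 M := .of_le (n := 3) (by norm_num)
  -- The tangent bundle loses one derivative: a `C^3` manifold has a `C^2` tangent bundle.
  have i3 : IsManifold (𝓡 d) (2 + 1) M := .of_le (n := 3) (by norm_num)
  have : ContMDiffVectorBundle 2 𝔼 (TangentSpace (𝓡 d) : M → Type _) (𝓡 d) :=
    TangentBundle.contMDiffVectorBundle
  have hφ : ContMDiffOn 𝓘(ℝ, 𝔼) (𝓡 d) 2 (chartAt 𝔼 p).symm (chartAt 𝔼 p).target :=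
    contMDiffOn_chart_symm
  have hframe : ∀ a : 𝔼, ContMDiffOn 𝓘(ℝ, 𝔼) ((𝓡 d).prod 𝓘(ℝ, 𝔼)) 2
      (fun v ↦ Bundle.TotalSpace.mk' 𝔼 (E := (TangentSpace (𝓡 d) : M → Type _))
        ((chartAt 𝔼 p).symm v)
        (mfderiv 𝓘(ℝ, 𝔼) (𝓡 d) (chartAt 𝔼 p).symm v a)) (chartAt 𝔼 p).target := by
    intro a
    set e := trivializationAt 𝔼 (TangentSpace (𝓡 d) : M → Type _) p with he
    have h1 := e.contMDiffOn_symm (IB := 𝓡 d) (n := 2)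
    have h2 : ContMDiffOn 𝓘(ℝ, 𝔼) ((𝓡 d).prod 𝓘(ℝ, 𝔼)) 2
        (fun v ↦ ((chartAt 𝔼 p).symm v, a)) (chartAt 𝔼 p).target :=
      hφ.prodMk contMDiffOn_const
    have hsrc : ∀ v ∈ (chartAt 𝔼 p).target, (chartAt 𝔼 p).symm v ∈ e.baseSet := by
      intro v hv
      simpa [he] using (chartAt 𝔼 p).map_target hv
    refine (h1.comp h2 fun v hv ↦ ?_).congr fun v hv ↦ ?_
    · simpa [e.mem_target] using hsrc v hv
    -- The coordinate frame is the constant vector `a` carried through the inverse of the tangent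
    -- trivialization at `p`, hence `C^2`.
    · have h3 := congrArg (fun L : 𝔼 →L[ℝ] 𝔼 ↦ L a) (TangentBundle.symmL_trivializationAt
        (I := 𝓡 d) (𝕜 := ℝ) (x₀ := p) ((chartAt 𝔼 p).map_target hv))
      have h4 : e.symm ((chartAt 𝔼 p).symm v) a
          = mfderiv 𝓘(ℝ, 𝔼) (𝓡 d) (chartAt 𝔼 p).symm v a := by
        refine (e.symmL_apply (R := ℝ) (hsrc v hv) a).symm.trans (h3.trans ?_)
        rw [modelWithCornersSelf_coe, range_id, mfderivWithin_univ]
        simp only [mfld_simps]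
        rw [(chartAt 𝔼 p).right_inv hv]
        rfl
      rw [Function.comp_apply, ← e.mk_symm (hsrc v hv)]
      exact congrArg _ h4.symm
  have hscalar : ∀ a b : 𝔼, ContDiffOn ℝ 2 (fun v ↦ g.inChart p v a b) (chartAt 𝔼 p).target := by
    intro a b
    have h1 : ContMDiffOn 𝓘(ℝ, 𝔼) ((𝓡 d).prod 𝓘(ℝ, ℝ)) 2
        (fun v ↦ Bundle.TotalSpace.mk' ℝ (E := Bundle.Trivial M ℝ) ((chartAt 𝔼 p).symm v)
          (g.inChart p v a b)) (chartAt 𝔼 p).target := by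
      simp only [inChart_apply]
      exact ContMDiffOn.clm_bundle_apply₂ (F₁ := 𝔼) (F₂ := 𝔼)
        (g.contMDiff.comp_contMDiffOn hφ) (hframe a) (hframe b)
    intro v hv
    exact (Bundle.contMDiffWithinAt_totalSpace.1 (h1 v hv)).2.contDiffWithinAt
  have h : ContDiffOn ℝ 2 (g.inChart p) (chartAt 𝔼 p).target :=
    contDiffOn_clm_apply.2 fun a ↦ contDiffOn_clm_apply.2 fun b ↦ hscalar a b
  exact h.contDiffAt ((chartAt 𝔼 p).open_target.mem_nhds hu)

/-- A chart expression of a differentiable curve is differentiable, and the metric coefficients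
applied to its derivative give the square of the velocity. -/
theorem hasDerivAt_chart_comp (g : LorentzianMetric d M) (p : M) {γ : ℝ → M} {t : ℝ}
    (hγ : MDifferentiableAt 𝓘(ℝ, ℝ) (𝓡 d) γ t) (ht : γ t ∈ (chartAt 𝔼 p).source) :
    ∃ v : 𝔼, HasDerivAt (fun s ↦ chartAt 𝔼 p (γ s)) v t ∧
      (v = 0 → curveVelocity (d := d) γ t = 0) ∧
      g.inChart p (chartAt 𝔼 p (γ t)) v v =
        g.val (γ t) (curveVelocity γ t) (curveVelocity γ t) := by
  have hm := mdifferentiable_chartAt (d := d) p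
  have h1 := (hm.mdifferentiableAt ht).hasMFDerivAt.comp t hγ.hasMFDerivAt
  obtain ⟨L, hL⟩ : ∃ L : ℝ →L[ℝ] 𝔼, L =
      (mfderiv (𝓡 d) 𝓘(ℝ, 𝔼) (chartAt 𝔼 p) (γ t)).comp (mfderiv 𝓘(ℝ, ℝ) (𝓡 d) γ t) := ⟨_, rfl⟩
  have h3 : HasFDerivAt (fun s ↦ chartAt 𝔼 p (γ s)) L t := by
    rw [hL]
    exact h1.hasFDerivAt
  have h4 : L 1 = mfderiv (𝓡 d) 𝓘(ℝ, 𝔼) (chartAt 𝔼 p) (γ t) (curveVelocity γ t) := by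
    rw [hL]
    rfl
  have h2 : mfderiv 𝓘(ℝ, 𝔼) (𝓡 d) (chartAt 𝔼 p).symm (chartAt 𝔼 p (γ t))
      (mfderiv (𝓡 d) 𝓘(ℝ, 𝔼) (chartAt 𝔼 p) (γ t) (curveVelocity γ t)) = curveVelocity γ t :=
    congrArg (fun L : TangentSpace (𝓡 d) (γ t) →L[ℝ] TangentSpace (𝓡 d) (γ t) ↦
      L (curveVelocity γ t)) (hm.symm_comp_deriv ht)
  rw [← h4] at h2
  refine ⟨L 1, h3.hasDerivAt, fun h0 ↦ ?_, ?_⟩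
  · rw [← h2, h0]
    exact map_zero _
  · rw [inChart_apply, h2, (chartAt 𝔼 p).left_inv ht]

/-- The metric coefficients at a point of the chart have an orthonormal basis. -/
theorem exists_inChart_orthonormal_basis (g : LorentzianMetric d M) (p : M) {u : 𝔼}
    (hu : u ∈ (chartAt 𝔼 p).target) :
    ∃ e : Module.Basis (Fin d) ℝ 𝔼, ∀ i j : Fin d,
      g.inChart p u (e i) (e j) = if i = j then (if (i : ℕ) = 0 then 1 else -1) else 0 := by
  have hm := mdifferentiable_chartAt (d := d) p
  obtain ⟨e, he⟩ := g.exists_orthonormal_basis ((chartAt 𝔼 p).symm u)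
  have hb : Function.Bijective (mfderiv 𝓘(ℝ, 𝔼) (𝓡 d) (chartAt 𝔼 p).symm u) :=
    hm.symm.mfderiv_bijective hu
  let A : 𝔼 ≃ₗ[ℝ] TangentSpace (𝓡 d) ((chartAt 𝔼 p).symm u) :=
    LinearEquiv.ofBijective
      (mfderiv 𝓘(ℝ, 𝔼) (𝓡 d) (chartAt 𝔼 p).symm u).toLinearMap hb
  have hA : ∀ i, mfderiv 𝓘(ℝ, 𝔼) (𝓡 d) (chartAt 𝔼 p).symm u (A.symm (e i)) = e i :=
    fun i ↦ A.apply_symm_apply (e i)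
  refine ⟨e.map A.symm, fun i j ↦ ?_⟩
  rw [inChart_apply, Module.Basis.map_apply, Module.Basis.map_apply, hA, hA, he]

end LorentzianMetric

/-! ### Linear algebra of Lorentzian forms -/

section Bilinear

variable {d : ℕ} {V : Type*} [NormedAddCommGroup V] [NormedSpace ℝ V]
  {B : V →L[ℝ] V →L[ℝ] ℝ} {e : Module.Basis (Fin d) ℝ V}

theorem bilin_apply_basis
    (he : ∀ i j : Fin d, B (e i) (e j) = if i = j then (if (i : ℕ) = 0 then 1 else -1) else 0)
    (v : V) (j : Fin d) : B v (e j) = e.repr v j * if (j : ℕ) = 0 then 1 else -1 := by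
  conv_lhs => rw [← e.sum_repr v]
  simp only [map_sum, map_smul, sum_apply, smul_apply, he,
    smul_eq_mul, mul_ite, mul_zero, Finset.sum_ite_eq', Finset.mem_univ, if_true]

theorem bilin_apply_self
    (he : ∀ i j : Fin d, B (e i) (e j) = if i = j then (if (i : ℕ) = 0 then 1 else -1) else 0)
    (v : V) : B v v = ∑ j, e.repr v j ^ 2 * if (j : ℕ) = 0 then 1 else -1 := by
  conv_lhs => rw [← e.sum_repr v]
  rw [map_sum]
  refine Finset.sum_congr rfl fun j _ ↦ ?_
  rw [map_smul, e.sum_repr, bilin_apply_basis he, smul_eq_mul]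
  ring

/-- A Lorentzian form is negative definite on the orthogonal complement of a timelike vector of an
orthonormal basis. -/
theorem bilin_apply_self_neg
    (he : ∀ i j : Fin d, B (e i) (e j) = if i = j then (if (i : ℕ) = 0 then 1 else -1) else 0)
    {i₀ : Fin d} (hi : (i₀ : ℕ) = 0) {v : V} (hv : v ≠ 0) (hv₀ : B v (e i₀) = 0) : B v v < 0 := by
  have h0 : e.repr v i₀ = 0 := by simpa [hi] using (bilin_apply_basis he v i₀).symm.trans hv₀
  obtain ⟨j, hj⟩ : ∃ j, e.repr v j ≠ 0 := by
    by_contra! h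
    exact hv (e.repr.map_eq_zero_iff.1 (Finsupp.ext h))
  have hterm : ∀ i, e.repr v i ^ 2 * (if (i : ℕ) = 0 then (1 : ℝ) else -1) = - e.repr v i ^ 2 := by
    intro i
    by_cases h : (i : ℕ) = 0
    · rw [show i = i₀ from Fin.ext (h.trans hi.symm), h0]
      simp
    · simp [h]
  rw [bilin_apply_self he, Finset.sum_congr rfl fun i _ ↦ hterm i, Finset.sum_neg_distrib,
    neg_lt_zero]
  exact Finset.sum_pos' (fun i _ ↦ sq_nonneg _) ⟨j, Finset.mem_univ _, by positivity⟩

/-- A Lorentzian form identifies the space with its dual. -/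
theorem bilin_isInvertible [FiniteDimensional ℝ V]
    (he : ∀ i j : Fin d, B (e i) (e j) = if i = j then (if (i : ℕ) = 0 then 1 else -1) else 0) :
    B.IsInvertible := by
  have hinj : Function.Injective B.toLinearMap := by
    refine (injective_iff_map_eq_zero _).2 fun v hv ↦ e.repr.map_eq_zero_iff.1 (Finsupp.ext ?_)
    intro j
    have h1 := bilin_apply_basis he v j
    have h2 : B v = 0 := hv
    rw [h2] at h1
    by_cases h : (j : ℕ) = 0 <;> simpa [h] using h1.symm
  have hdim : Module.finrank ℝ V = Module.finrank ℝ (V →L[ℝ] ℝ) := by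
    rw [← (LinearMap.toContinuousLinearMap (𝕜 := ℝ) (E := V) (F' := ℝ)).finrank_eq]
    exact (Subspace.dual_finrank_eq (K := ℝ) (V := V)).symm
  exact ⟨(LinearMap.linearEquivOfInjective B.toLinearMap hinj hdim).toContinuousLinearEquiv, rfl⟩

end Bilinear

/-! ### The geodesic equation as an ODE -/

section GeodesicEquation

variable {V : Type*} [NormedAddCommGroup V] [NormedSpace ℝ V]

/-- The Christoffel form `w ↦ Γ(v, v; w)` of the first kind of a field `G` of bilinear forms. -/
noncomputable def christoffelForm (G : V → V →L[ℝ] V →L[ℝ] ℝ) (u v : V) : V →L[ℝ] ℝ :=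
  (1 / 2 : ℝ) • (fderiv ℝ G u v v + fderiv ℝ G u v v -
    (ContinuousLinearMap.apply ℝ ℝ v).comp
      ((ContinuousLinearMap.apply ℝ (V →L[ℝ] ℝ) v).comp (fderiv ℝ G u)))

/-- The geodesic equation as a first order system. -/
noncomputable def geodesicField (G : V → V →L[ℝ] V →L[ℝ] ℝ) (q : V × V) : V × V :=
  (q.2, -(G q.1).inverse (christoffelForm G q.1 q.2))

-- The Christoffel form costs one derivative of `G`, and inversion of operators is smooth at
-- invertible ones. `C^1` is what Picard–Lindelöf needs.
set_option maxSynthPendingDepth 5 in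
theorem contDiffAt_geodesicField [CompleteSpace V] {G : V → V →L[ℝ] V →L[ℝ] ℝ} {u v : V}
    (hG : ContDiffAt ℝ 2 G u) (hinv : (G u).IsInvertible) :
    ContDiffAt ℝ 1 (geodesicField G) (u, v) := by
  have h1 : ContDiffAt ℝ 1 (fun q : V × V ↦ G q.1) (u, v) :=
    (hG.of_le (by norm_num)).comp (u, v) contDiffAt_fst
  have h2 : ContDiffAt ℝ 1 (fun q : V × V ↦ fderiv ℝ G q.1) (u, v) :=
    (hG.fderiv_right (m := 1) (by norm_num)).comp (u, v) contDiffAt_fst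
  have h3 : ContDiffAt ℝ 1 (fun q : V × V ↦ (G q.1).inverse) (u, v) :=
    ContDiffAt.comp (u, v) (f := fun q : V × V ↦ G q.1) hinv.contDiffAt_map_inverse h1
  have hsnd : ContDiffAt ℝ 1 (fun q : V × V ↦ q.2) (u, v) := contDiffAt_snd
  have h4 : ContDiffAt ℝ 1 (fun q : V × V ↦ christoffelForm G q.1 q.2) (u, v) := by
    have h5 := (h2.clm_apply hsnd).clm_apply hsnd
    have h6 := ((ContinuousLinearMap.apply ℝ ℝ (E := V)).contDiff (n := 1)).contDiffAt.comp
      (u, v) hsnd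
    have h7 := ((ContinuousLinearMap.apply ℝ (V →L[ℝ] ℝ) (E := V)).contDiff
      (n := 1)).contDiffAt.comp (u, v) hsnd
    exact ((h5.add h5).sub (h6.clm_comp (h7.clm_comp h2))).const_smul (1 / 2 : ℝ)
  exact hsnd.prodMk (h3.clm_apply h4).neg

/-- Local existence of solutions of the geodesic equation. -/
theorem exists_geodesicEquation_solution [CompleteSpace V] {G : V → V →L[ℝ] V →L[ℝ] ℝ} {u : V}
    (hG : ContDiffAt ℝ 2 G u) (hinv : (G u).IsInvertible) (v : V) :
    ∃ c : ℝ → V, c 0 = u ∧ deriv c 0 = v ∧ ∀ᶠ t in 𝓝 (0 : ℝ), ContDiffAt ℝ 2 c t ∧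
      ∀ w, G (c t) (deriv (deriv c) t) w + christoffelForm G (c t) (deriv c t) w = 0 := by
  have hF := contDiffAt_geodesicField (v := v) hG hinv
  obtain ⟨α, hα0, ε, hε, hα⟩ :=
    hF.exists_forall_mem_closedBall_exists_eq_forall_mem_Ioo_hasDerivAt₀ 0
  have hsol : ∀ᶠ t in 𝓝 (0 : ℝ), HasDerivAt α (geodesicField G (α t)) t :=
    eventually_of_mem (Ioo_mem_nhds (by linarith) (by linarith)) hα
  have hαc : Tendsto α (𝓝 0) (𝓝 (u, v)) := hα0 ▸ hsol.self_of_nhds.continuousAt.tendsto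
  have hFc : ∀ᶠ t in 𝓝 (0 : ℝ), ContinuousAt (geodesicField G) (α t) :=
    hαc.eventually ((hF.eventually (by simp)).mono fun _ h ↦ h.continuousAt)
  have hGinv : ∀ᶠ t in 𝓝 (0 : ℝ), (G (α t).1).IsInvertible := by
    obtain ⟨e, he⟩ := hinv
    have h1 : Tendsto (fun t ↦ G (α t).1) (𝓝 0) (𝓝 (e : V →L[ℝ] V →L[ℝ] ℝ)) := by
      rw [he]
      exact hG.continuousAt.tendsto.comp ((continuous_fst.tendsto _).comp hαc)
    exact h1.eventually (ContinuousLinearEquiv.nhds e)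
  have hfst : ∀ t, HasDerivAt α (geodesicField G (α t)) t →
      HasDerivAt (fun s ↦ (α s).1) (α t).2 t := fun t ht ↦ by simpa [geodesicField] using ht.hasFDerivAt.fst.hasDerivAt
  have hsnd : ∀ t, HasDerivAt α (geodesicField G (α t)) t →
      HasDerivAt (fun s ↦ (α s).2) (geodesicField G (α t)).2 t :=
    fun t ht ↦ by simpa using ht.hasFDerivAt.snd.hasDerivAt
  have hd1 : ∀ᶠ t in 𝓝 (0 : ℝ), deriv (fun s ↦ (α s).1) t = (α t).2 :=
    hsol.mono fun t ht ↦ (hfst t ht).deriv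
  refine ⟨fun t ↦ (α t).1, by simp [hα0], by rw [hd1.self_of_nhds, hα0], ?_⟩
  filter_upwards [hsol.eventually_nhds, hFc.eventually_nhds, hGinv, hd1.eventually_nhds]
    with t h1 h2 h3 h4
  obtain ⟨s, hs, hso, hts⟩ := eventually_nhds_iff.1 (h1.and (h2.and h4))
  have hdd : ∀ r ∈ s, deriv (fun s ↦ (α s).2) r = (geodesicField G (α r)).2 :=
    fun r hr ↦ (hsnd r (hs r hr).1).deriv
  constructor
  -- Bootstrap: the field is continuous along `α`, so the velocity is `C^1`, hence the position is
  -- `C^2`.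
  · have hc2 : ContDiffOn ℝ (0 + 1) (fun t ↦ (α t).2) s := by
      refine (contDiffOn_succ_iff_deriv_of_isOpen hso).2 ⟨fun r hr ↦
        (hsnd r (hs r hr).1).differentiableAt.differentiableWithinAt, by simp, ?_⟩
      refine contDiffOn_zero.2 (ContinuousOn.congr (fun r hr ↦ ?_) hdd)
      have := ContinuousAt.comp (f := α) (x := r) (hs r hr).2.1 (hs r hr).1.continuousAt
      exact (continuousAt_snd.comp this).continuousWithinAt
    have hc : ContDiffOn ℝ (1 + 1) (fun t ↦ (α t).1) s := by
      refine (contDiffOn_succ_iff_deriv_of_isOpen hso).2 ⟨fun r hr ↦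
        (hfst r (hs r hr).1).differentiableAt.differentiableWithinAt, by simp, ?_⟩
      rw [zero_add] at hc2
      exact hc2.congr fun r hr ↦ (hs r hr).2.2
    rw [one_add_one_eq_two] at hc
    exact hc.contDiffAt (hso.mem_nhds hts)
  · intro w
    have h5 : deriv (deriv fun s ↦ (α s).1) t = (geodesicField G (α t)).2 := by
      rw [EventuallyEq.deriv_eq h4, hdd t hts]
    rw [h5, h4.self_of_nhds, geodesicField, map_neg, h3.self_apply_inverse]
    simp

end GeodesicEquation

/-! ### Separated points accumulate at every point -/

namespace LorentzianMetric

variable {d : ℕ} {M : Type*} [TopologicalSpace M]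
  [ChartedSpace (EuclideanSpace ℝ (Fin d)) M] [IsManifold (𝓡 d) 3 M]

local notation "𝔼" => EuclideanSpace ℝ (Fin d)

theorem christoffelFirst_self (g : LorentzianMetric d M) (p : M) (u v w : 𝔼) :
    g.christoffelFirst p u v v w = christoffelForm (g.inChart p) u v w := by
  simp [christoffelFirst, christoffelForm]

/-- A subspace on which the metric coefficients are negative definite at a point remains negative
definite nearby. -/
theorem eventually_inChart_neg (g : LorentzianMetric d M) (p : M) {u₀ : 𝔼}
    (hu : u₀ ∈ (chartAt 𝔼 p).target) {τ : 𝔼 →L[ℝ] ℝ}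
    (hτ : ∀ v, v ≠ 0 → τ v = 0 → g.inChart p u₀ v v < 0) :
    ∀ᶠ u in 𝓝 u₀, ∀ v, v ≠ 0 → τ v = 0 → g.inChart p u v v < 0 := by
  -- Compactness of the unit sphere in `ker τ` makes the neighbourhood uniform in `v`; homogeneity
  -- then covers all nonzero `v`.
  have hK : IsCompact (Metric.sphere (0 : 𝔼) 1 ∩ {v | τ v = 0}) :=
    (isCompact_sphere 0 1).inter_right (isClosed_eq τ.continuous continuous_const)
  have h := hK.eventually_forall_of_forall_eventually (x₀ := u₀)
    (P := fun u v ↦ g.inChart p u v v < 0) fun v hv ↦ by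
      have hc : ContinuousAt (fun z : 𝔼 × 𝔼 ↦ g.inChart p z.1 z.2 z.2) (u₀, v) := by
        have h1 : ContinuousAt (fun z : 𝔼 × 𝔼 ↦ g.inChart p z.1) (u₀, v) :=
          ContinuousAt.comp (f := Prod.fst) (g := g.inChart p) (x := (u₀, v)) (g.contDiffAt_inChart p hu).continuousAt
            continuousAt_fst
        exact (h1.clm_apply continuousAt_snd).clm_apply continuousAt_snd
      refine hc.eventually_lt_const (hτ v (fun h0 ↦ ?_) hv.2)
      simpa [h0] using hv.1
  filter_upwards [h] with u hu v hv hv0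
  have hn : 0 < ‖v‖ := norm_pos_iff.2 hv
  have h1 := hu (‖v‖⁻¹ • v) ⟨by simp [norm_smul, hn.ne'], by simp [hv0]⟩
  have h2 : g.inChart p u (‖v‖⁻¹ • v) (‖v‖⁻¹ • v) = (‖v‖⁻¹) ^ 2 * g.inChart p u v v := by
    simp
    ring
  rw [h2] at h1
  exact neg_of_mul_neg_right h1 (by positivity)

/-- In a distinguishing spacetime of dimension at least two, every point is a limit of points
causally disjoint from it. -/
theorem IsDistinguishing.frequently_causallyDisjoint (hd : 2 ≤ d) {g : LorentzianMetric d M}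
    (hg : g.IsDistinguishing) (x : M) : ∃ᶠ y in 𝓝 x, g.CausallyDisjoint x y := by
  set φ := chartAt 𝔼 x with hφ
  have hx : x ∈ φ.source := mem_chart_source 𝔼 x
  have hu : φ x ∈ φ.target := φ.map_source hx
  obtain ⟨e, he⟩ := g.exists_inChart_orthonormal_basis x hu
  let i₀ : Fin d := ⟨0, by omega⟩
  let i₁ : Fin d := ⟨1, by omega⟩
  let τ : 𝔼 →L[ℝ] ℝ := (g.inChart x (φ x)).flip (e i₀)
  have hτ₁ : τ (e i₁) = 0 := by simp [τ, he, i₀, i₁]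
  have hneg := g.eventually_inChart_neg x hu (τ := τ)
    fun v hv hv0 ↦ bilin_apply_self_neg he rfl hv hv0
  obtain ⟨V, hV, -, hcaus⟩ := hg x _ (inter_mem (φ.open_source.mem_nhds hx)
    ((φ.continuousAt hx).eventually hneg))
  -- Moving along `e i₁`, which lies in `ker τ`, keeps the value of `τ`, as Rolle's theorem will
  -- require.
  let ξ : ℝ → 𝔼 := fun s ↦ φ x + s • e i₁
  have hξ : Tendsto ξ (𝓝 0) (𝓝 (φ x)) := by
    have : Continuous ξ := by fun_prop
    simpa [ξ] using this.tendsto 0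
  have hy : Tendsto (fun s ↦ φ.symm (ξ s)) (𝓝 0) (𝓝 x) := by
    have := (φ.continuousAt_symm hu).tendsto.comp hξ
    rwa [φ.left_inv hx] at this
  have hev : ∀ᶠ s in 𝓝[≠] (0 : ℝ), g.CausallyDisjoint x (φ.symm (ξ s)) := by
    filter_upwards [(hξ.eventually (φ.open_target.mem_nhds hu)).filter_mono nhdsWithin_le_nhds,
      (hy.eventually hV).filter_mono nhdsWithin_le_nhds, self_mem_nhdsWithin] with s hs hsV hs0
    refine ⟨fun h ↦ ?_, ?_⟩
    · have h1 : φ x = ξ s := by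
        conv_lhs => rw [h]
        exact φ.right_inv hs
      have h2 : s • e i₁ = 0 := by simpa [ξ] using h1
      exact (smul_eq_zero.1 h2).elim hs0 (e.ne_zero i₁)
    · rintro ⟨γ, a, b, hab, ha, hb, hγ⟩
      have hU := hcaus γ a b hab ha (hb ▸ hsV) hγ
      have hderiv : ∀ t ∈ Icc a b, ∃ v : 𝔼, HasDerivAt (fun s ↦ φ (γ s)) v t ∧ τ v ≠ 0 := by
        intro t ht
        obtain ⟨v, hv, hv0, hvv⟩ := g.hasDerivAt_chart_comp x
          ((hγ t ht).1.mdifferentiableAt one_ne_zero) (hU t ht).1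
        refine ⟨v, hv, fun h ↦ ?_⟩
        have := (hU t ht).2 v (fun h ↦ (hγ t ht).2.1 (hv0 h)) h
        rw [hvv] at this
        exact this.not_ge (hγ t ht).2.2
      choose! v hv hv0 using hderiv
      have hτv : ∀ t ∈ Icc a b, HasDerivAt (fun s ↦ τ (φ (γ s))) (τ (v t)) t :=
        fun t ht ↦ τ.hasFDerivAt.comp_hasDerivAt t (hv t ht)
      obtain ⟨t, ht, ht0⟩ := exists_hasDerivAt_eq_zero hab
        (fun t ht ↦ (hτv t ht).continuousAt.continuousWithinAt)
        (by rw [ha, hb, φ.right_inv hs]; simp [ξ, hτ₁])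
        fun t ht ↦ hτv t (Ioo_subset_Icc_self ht)
      exact hv0 t (Ioo_subset_Icc_self ht) ht0
  exact hy.frequently (hev.frequently.filter_mono nhdsWithin_le_nhds)

/-- In dimension at least two, every point is a limit of points to which it is joined by spacelike
geodesics. -/
theorem frequently_geodesicallySpacelikeSeparated (hd : 2 ≤ d) (g : LorentzianMetric d M) (x : M) :
    ∃ᶠ y in 𝓝 x, g.GeodesicallySpacelikeSeparated x y := by
  set φ := chartAt 𝔼 x with hφ
  have hx : x ∈ φ.source := mem_chart_source 𝔼 x
  have hu : φ x ∈ φ.target := φ.map_source hx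
  obtain ⟨e, he⟩ := g.exists_inChart_orthonormal_basis x hu
  let i₁ : Fin d := ⟨1, by omega⟩
  obtain ⟨c, hc0, hc0', hc⟩ := exists_geodesicEquation_solution (g.contDiffAt_inChart x hu)
    (bilin_isInvertible he) (e i₁)
  have hC : ContDiffAt ℝ 2 c 0 := hc.self_of_nhds.1
  have hct : Tendsto c (𝓝 0) (𝓝 (φ x)) := hc0 ▸ hC.continuousAt.tendsto
  have hcd : ContinuousAt (deriv c) 0 :=
    ((hC.fderiv_right (m := 0) (by norm_num)).continuousAt).clm_apply continuousAt_const
  have hneg : ∀ᶠ t in 𝓝 (0 : ℝ), g.inChart x (c t) (deriv c t) (deriv c t) < 0 := by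
    have h1 : ContinuousAt (fun t ↦ g.inChart x (c t)) 0 :=
      ContinuousAt.comp (f := c) (g := g.inChart x) (hc0 ▸ (g.contDiffAt_inChart x hu).continuousAt) hC.continuousAt
    refine ((h1.clm_apply hcd).clm_apply hcd).eventually_lt_const ?_
    simp [hc0, hc0', he, i₁]
  have hy : Tendsto (fun s ↦ φ.symm (c s)) (𝓝 0) (𝓝 x) := by
    have := (φ.continuousAt_symm hu).tendsto.comp hct
    rwa [φ.left_inv hx] at this
  have hmem : ∀ᶠ t in 𝓝 (0 : ℝ), c t ∈ φ.target := hct.eventually (φ.open_target.mem_nhds hu)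
  have hgeo : ∀ᶠ t in 𝓝 (0 : ℝ), g.IsGeodesicAt (fun s ↦ φ.symm (c s)) t ∧
      g.val (φ.symm (c t)) (curveVelocity (d := d) (fun s ↦ φ.symm (c s)) t)
        (curveVelocity (d := d) (fun s ↦ φ.symm (c s)) t) < 0 := by
    filter_upwards [hc, hneg, hmem.eventually_nhds] with t ht hnt hmt
    -- `c` may leave the chart target for distant parameters, but the geodesic equation only sees
    -- the germ at `t`.
    have heq : (fun s ↦ φ (φ.symm (c s))) =ᶠ[𝓝 t] c := hmt.mono fun s hs ↦ φ.right_inv hs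
    have hmt' := hmt.self_of_nhds
    have hdc := ht.1.differentiableAt (by norm_num)
    constructor
    · refine ⟨ContinuousAt.comp (f := c) (φ.continuousAt_symm hmt') ht.1.continuousAt, x,
        φ.map_target hmt', ht.1.congr_of_eventuallyEq heq, fun w ↦ ?_⟩
      rw [heq.deriv.deriv_eq, heq.deriv.eq_of_nhds, christoffelFirst_self]
      beta_reduce
      rw [← hφ, φ.right_inv hmt']
      exact ht.2 w
    · have hmd : MDifferentiableAt 𝓘(ℝ, ℝ) (𝓡 d) (fun s ↦ φ.symm (c s)) t :=
        MDifferentiableAt.comp t ((mdifferentiable_chartAt (d := d) x).mdifferentiableAt_symm hmt')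
          hdc.mdifferentiableAt
      obtain ⟨v, hv, -, hvv⟩ := g.hasDerivAt_chart_comp x hmd (φ.map_target hmt')
      have hvc : v = deriv c t := hv.unique (hdc.hasDerivAt.congr_of_eventuallyEq heq)
      rw [← hvv, hvc, ← hφ, φ.right_inv hmt']
      exact hnt
  obtain ⟨δ, hδ, hball⟩ := Metric.eventually_nhds_iff.1 hgeo
  have hev : ∀ᶠ b in 𝓝[>] (0 : ℝ), g.GeodesicallySpacelikeSeparated x (φ.symm (c b)) := by
    -- The nonzero initial velocity prevents an immediate return to the starting point.
    have hne : ∀ᶠ b in 𝓝[>] (0 : ℝ), c b ≠ c 0 :=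
      ((hC.differentiableAt (by norm_num)).hasDerivAt.eventually_ne
        (hc0' ▸ e.ne_zero i₁)).filter_mono (nhdsWithin_mono _ fun b hb ↦ ne_of_gt hb)
    filter_upwards [hne, Ioo_mem_nhdsGT hδ, hmem.filter_mono nhdsWithin_le_nhds] with b hb hbδ hbm
    refine ⟨fun h ↦ hb ?_, fun s ↦ φ.symm (c s), 0, b, hbδ.1, ?_, rfl, fun t ht ↦ hball ?_⟩
    · rw [hc0, h, φ.right_inv hbm]
    · simp only [hc0, φ.left_inv hx]
    · rw [Real.dist_eq, sub_zero, abs_of_nonneg ht.1]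
      exact ht.2.trans_lt hbδ.2
  exact hy.frequently (hev.frequently.filter_mono nhdsWithin_le_nhds)

end LorentzianMetric

theorem theorem2 {d : ℕ} (hd : 2 ≤ d) {M : Type*} [TopologicalSpace M]
    [ChartedSpace (EuclideanSpace ℝ (Fin d)) M] [IsManifold (𝓡 d) 3 M]
    (g : LorentzianMetric d M)
    {H : Type*} [NormedAddCommGroup H] [InnerProductSpace ℂ H] [CompleteSpace H]
    (D : Submodule ℂ H) (hD : Dense (D : Set H))
    (ψ : M → D →ₗ[ℂ] H) (hcont : WeaklyContinuous D ψ)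
    (hinv : ∀ x : M, DomainInvariant D (ψ x)) :
    ((∀ x y : M, g.GeodesicallySpacelikeSeparated x y →
        anticommutator (hinv x).adj (hinv y).op = 0) ↔ ∀ x : M, ψ x = 0) ∧
    (g.IsDistinguishing →
      ((∀ x y : M, g.CausallyDisjoint x y →
        anticommutator (hinv x).adj (hinv y).op = 0) ↔ ∀ x : M, ψ x = 0)) := by
  refine ⟨⟨fun h x ↦ ?_, fun h x y _ ↦ ?_⟩, fun hg ↦ ⟨fun h x ↦ ?_, fun h x y _ ↦ ?_⟩⟩
  · exact eq_zero_of_frequently_anticommutator_eq_zero hD hcont hinv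
      ((g.frequently_geodesicallySpacelikeSeparated hd x).mono (h x))
  · exact anticommutator_eq_zero_of_eq_zero _ _ (h y)
  · exact eq_zero_of_frequently_anticommutator_eq_zero hD hcont hinv
      ((hg.frequently_causallyDisjoint hd x).mono (h x))
  · exact anticommutator_eq_zero_of_eq_zero _ _ (h y)
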